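/- **Setting.** Let $\Omega\subset\mathbb R^3$ be a bounded domain with Lipschitz boundary and $\Omega_r=\{x\in\Omega:\operatorname{dist}(x,\partial\Omega)>r\}$. For $u\in SBV(\Omega;\mathbb R^3)$ write $Du=\nabla u\,\mathcal L^3+D^su$ (absolutely continuous and singular parts). Let $\alpha\in C_c^\infty(\mathbb R^3)$ with $\operatorname{spt}\alpha\subset B_1$ and $\int\alpha=1$, and $\alpha_r(x)=r^{-3}\alpha(x/r)$; for a measure $\mu$ on $\Omega$ put $(\mu*\alpha_r)(x)=\int_\Omega\alpha_r(x-y)\,d\mu(y)$, and similarly for integrable fields on $\Omega$. Fix slip systems: orthogonal unit vectors $(s^a,m^a)$ and numbers $p^a>0$, $a=1,\dots,A$. An *invertible structured deformation* is a pair $(g,G)\in SBV(\Omega;\mathbb R^3)\times L^1(\Omega;\mathbb R^{3\times3})$ such that $g$ is a $C^1$ diffeomorphism of $\Omega$ onto its (open) image with $\nabla g$ and $x\mapsto\nabla g(x)^{-1}$ Lipschitz on $\Omega$, $G$ is continuous on $\overline\Omega$ with invertible values, and $\det\nabla g=\det G$ on $\Omega$. Put $K_{(g,G)}=(\nabla g)^{-1}G$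 and $M_{(i,K_{(g,G)})}=I-K_{(g,G)}$. The pair is *crystallographic* if in addition there are functions $\gamma^a:\Omega\to\mathbb R$ with $M_{(i,K_{(g,G)})}(x)=\sum_{a}\gamma^a(x)\,s^a\otimes m^a$ for all $x\in\Omega$. A sequence $(u_n)\subset SBV(\Omega;\mathbb R^3)$ is *admissible* for $(g,G)$ if $u_n\to g$ in $L^1(\Omega)$, and $\nabla u_n\,\mathcal L^3\rightharpoonup^* G\,\mathcal L^3$ and $D^su_n\rightharpoonup^*(\nabla g-G)\mathcal L^3+D^sg$ weakly-* as measures on $\Omega$ (tested with $C_0(\Omega)$). Let $\Psi_i:\mathbb R^{3\times3}\to\mathbb R$ be Lipschitz continuous and sublinear at infinity ($\Psi_i(L)/|L|\to0$ as $|L|\to\infty$), and suppose that for all $a,b\in\{1,\dots,A\}$ and $\xi\in\mathbb R$ the map $$s\mapsto\Psi_i\big(s\otimes m^a+\xi\,(m^a\times m^b)\otimes m^b\big)\qquad(\ast)$$ is periodic on $\{m^a\}^\perp$ with period $p^as^a$. For a crystallographic $(g,G)$ put $\Psi_g(x,L)=\Psi_i(\nabla g(x)^{-1}L)$ and $E_g^{\alpha_r}(u)=\int_{\Omega_r}\Psi_g\big(x,(D^su*\alpha_r)(x)\big)\,dx$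 for $u\in SBV(\Omega;\mathbb R^3)$, and let $$I^{\alpha_r}(g,G;\Omega_r)=\int_{\Omega_r}\Psi_g\big(x,(((\nabla g-G)\mathcal L^3+D^sg)*\alpha_r)(x)\big)\,dx .$$ **Theorem.** For every crystallographic $(g,G)$, all integrals below and those defining $E_g^{\alpha_r}(u)$ converge, and: 1. for every $r>0$ and every admissible sequence $(u_n)$ for $(g,G)$, $$\lim_{n\to\infty}E_g^{\alpha_r}(u_n)=I^{\alpha_r}(g,G;\Omega_r)=\int_{\Omega_r}\Psi_g\big(x,((\nabla g-G)*\alpha_r)(x)\big)\,dx;$$ 2. the localized energy is $$I(g,G)=\lim_{r\to0^+}I^{\alpha_r}(g,G;\Omega_r)=\int_\Omega\Psi_g(x,\nabla g-G)\,dx=\int_\Omega\Psi_i(I-\nabla g^{-1}G)\,dx=\int_\Omega\Psi_i(I-K_{(g,G)})\,dx=\int_\Omega\Psi_i(M_{(i,K_{(g,G)})})\,dx;$$ 3. the bulk density $x\mapsto\Psi_g(x,\nabla g(x)-G(x))=\Psi_i(M_{(i,K_{(g,G)})}(x))$ is frame-indifferent: for every rotation $Q\in SO(3)$ and $c\in\mathbb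 R^3$, the pair $(Qg+c,QG)$ has the same density at every $x\in\Omega$; 4. the bulk density retains the periodicity $(\ast)$: for every $x\in\Omega$ the function $M\mapsto\Psi_g(x,\nabla g(x)M)$ satisfies $(\ast)$ in place of $\Psi_i$; and if $(g',G')$ is crystallographic, $s\perp m^a$, $n\in\mathbb Z$, $M_{(i,K_{(g,G)})}(x)=s\otimes m^a+\xi(m^a\times m^b)\otimes m^b$ and $M_{(i,K_{(g',G')})}(x)=(s+np^as^a)\otimes m^a+\xi(m^a\times m^b)\otimes m^b$, then the two densities agree at $x$. -/

import Mathlib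

open MeasureTheory Set Filter Topology Metric
open scoped ContDiff Matrix

attribute [local instance] Matrix.frobeniusNormedAddCommGroup

noncomputable section

namespace SlipEnergy

/-- Euclidean space `ℝ³`. -/
abbrev E3 : Type := EuclideanSpace ℝ (Fin 3)

/-- Real `3 × 3` matrices; the norm in force is the Euclidean (Frobenius) norm. -/
abbrev Mat : Type := Matrix (Fin 3) (Fin 3) ℝ

/-! ### Domains -/

/-- A bounded domain (nonempty, connected, open, bounded set) of `ℝ³` whose boundary is, near each
of its points and in suitable orthonormal coordinates, the graph of a Lipschitz function, the set
lying on one side of that graph. -/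
structure IsLipschitzDomain (Ω : Set E3) : Prop where
  isOpen : IsOpen Ω
  isConnected : IsConnected Ω
  isBounded : Bornology.IsBounded Ω
  lipschitz_boundary : ∀ x ∈ frontier Ω, ∃ (T : E3 ≃ₗᵢ[ℝ] E3) (ρ : ℝ)
    (f : EuclideanSpace ℝ (Fin 2) → ℝ), 0 < ρ ∧ (∃ C, LipschitzWith C f) ∧
      ∀ y ∈ ball x ρ, y ∈ Ω ↔ f !₂[T y 0, T y 1] < T y 2

/-- `Ω_r`, the points of `Ω` at distance larger than `r` from the boundary. -/
def innerSet (Ω : Set E3) (r : ℝ) : Set E3 := {x ∈ Ω | r < infDist x (frontier Ω)}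

/-! ### Functions of bounded variation -/

/-- `∂_j φ`. -/
def partialDeriv (φ : E3 → ℝ) (j : Fin 3) (x : E3) : ℝ :=
  fderiv ℝ φ x (EuclideanSpace.single j 1)

/-- The finite matrix-valued Borel measure `μ` on `Ω` (given by its entries, which are signed
measures on `ℝ³` carried by `Ω`) is the distributional derivative of `u` on `Ω`. -/
def IsDistribDeriv (Ω : Set E3) (u : E3 → E3) (μ : Fin 3 → Fin 3 → SignedMeasure E3) : Prop :=
  (∀ i j, ∀ B : Set E3, MeasurableSet B → Disjoint B Ω → μ i j B = 0) ∧
  ∀ φ : E3 → ℝ, ContDiff ℝ ∞ φ → HasCompactSupport φ → tsupport φ ⊆ Ω →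
    ∀ i j, ∫ x in Ω, u x i * partialDeriv φ j x = - ∫ᵛ x, φ x ∂•(μ i j)

open Classical in
/-- The distributional derivative `Du` on `Ω` (equal to `0` when it is not a finite measure). -/
def distribDeriv (Ω : Set E3) (u : E3 → E3) : Fin 3 → Fin 3 → SignedMeasure E3 :=
  if h : ∃ μ, IsDistribDeriv Ω u μ then h.choose else 0

/-- `∇u`, the density of the absolutely continuous part of `Du` with respect to Lebesgue measure. -/
def approxGrad (Ω : Set E3) (u : E3 → E3) (x : E3) : Mat :=
  Matrix.of fun i j => (distribDeriv Ω u i j).rnDeriv volume x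

/-- `Dˢu`, the singular part of `Du` with respect to Lebesgue measure. -/
def singularDeriv (Ω : Set E3) (u : E3 → E3) (i j : Fin 3) : SignedMeasure E3 :=
  (distribDeriv Ω u i j).singularPart volume

/-- The jump set `S_u`: the points of `Ω` at which `u` has two different one-sided approximate
limits `a`, `b` with respect to some plane with unit normal `ν`. -/
def jumpSet (Ω : Set E3) (u : E3 → E3) : Set E3 :=
  {x ∈ Ω | ∃ a b ν : E3, a ≠ b ∧ ‖ν‖ = 1 ∧
    Tendsto (fun ε : ℝ => (ε ^ 3)⁻¹ *
      ∫ y in {y ∈ ball x ε | 0 < inner ℝ (y - x) ν}, ‖u y - a‖) (𝓝[>] 0) (𝓝 0) ∧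
    Tendsto (fun ε : ℝ => (ε ^ 3)⁻¹ *
      ∫ y in {y ∈ ball x ε | inner ℝ (y - x) ν < 0}, ‖u y - b‖) (𝓝[>] 0) (𝓝 0)}

/-- `u ∈ SBV(Ω; ℝ³)`: `u` is integrable, `Du` is a finite measure and `Dˢu` has no Cantor part,
i.e. `Dˢu` vanishes off the jump set. -/
structure IsSBV (Ω : Set E3) (u : E3 → E3) : Prop where
  integrable : IntegrableOn u Ω
  bv : ∃ μ, IsDistribDeriv Ω u μ
  no_cantor : ∀ i j, ∀ B : Set E3, MeasurableSet B → Disjoint B (jumpSet Ω u) →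
    singularDeriv Ω u i j B = 0

/-! ### Structured deformations -/

/-- `(g, G) ∈ SD(Ω) = SBV(Ω; ℝ³) × L¹(Ω; ℝ^{3×3})`. -/
def IsSD (Ω : Set E3) (g : E3 → E3) (G : E3 → Mat) : Prop :=
  IsSBV Ω g ∧ ∀ i j, IntegrableOn (fun x => G x i j) Ω

/-- `φ ∈ C₀(Ω)`: the functions in `C₀(ℝ³)` that vanish outside the open set `Ω`. -/
def IsC0Test (Ω : Set E3) (φ : ZeroAtInftyContinuousMap E3 ℝ) : Prop := ∀ x, x ∉ Ω → φ x = 0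

/-- Admissible sequences `u ∈ Ad(g, G)`: `u_n ∈ SBV(Ω; ℝ³)`, `u_n → g` in `L¹`, `∇u_n ⇀* G` and
`Dˢu_n ⇀* (∇g - G) 𝓛³ + Dˢg` weakly-* as measures on `Ω`. -/
structure IsAdmissible (Ω : Set E3) (g : E3 → E3) (G : E3 → Mat) (u : ℕ → E3 → E3) : Prop where
  sbv : ∀ n, IsSBV Ω (u n)
  tendsto_L1 : Tendsto (fun n => ∫ x in Ω, ‖u n x - g x‖) atTop (𝓝 0)
  tendsto_grad : ∀ i j, ∀ φ : ZeroAtInftyContinuousMap E3 ℝ, IsC0Test Ω φ →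
    Tendsto (fun n => ∫ x in Ω, φ x * approxGrad Ω (u n) x i j) atTop
      (𝓝 (∫ x in Ω, φ x * G x i j))
  tendsto_singular : ∀ i j, ∀ φ : ZeroAtInftyContinuousMap E3 ℝ, IsC0Test Ω φ →
    Tendsto (fun n => ∫ᵛ x, φ x ∂•(singularDeriv Ω (u n) i j)) atTop
      (𝓝 ((∫ x in Ω, φ x * (approxGrad Ω g x - G x) i j) +
        ∫ᵛ x, φ x ∂•(singularDeriv Ω g i j)))

/-! ### Averaged energies -/

/-- A smooth kernel `α` with support in the open unit ball and integral `1`. -/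
structure IsKernel (α : E3 → ℝ) : Prop where
  smooth : ContDiff ℝ ∞ α
  support : tsupport α ⊆ ball 0 1
  integral_one : ∫ x, α x = 1

/-- `α_r(x) = r⁻³ α(x / r)`. -/
def scaled (α : E3 → ℝ) (r : ℝ) (x : E3) : ℝ := (r ^ 3)⁻¹ * α (r⁻¹ • x)

/-- The convolution `(μ * a)(x)` of a matrix-valued measure with a scalar function. -/
def measConv (μ : Fin 3 → Fin 3 → SignedMeasure E3) (a : E3 → ℝ) (x : E3) : Mat :=
  Matrix.of fun i j => ∫ᵛ y, a (x - y) ∂•(μ i j)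

/-- The convolution `(F * a)(x)` of a matrix field on `Ω` with a scalar function. -/
def fieldConv (Ω : Set E3) (F : E3 → Mat) (a : E3 → ℝ) (x : E3) : Mat :=
  Matrix.of fun i j => ∫ y in Ω, a (x - y) * F y i j

/-- The averaged interfacial energy `E^{α_r}(u) = ∫_{Ω_r} Ψ(x, (Dˢu * α_r)(x)) dx`. -/
def interfacialEnergy (Ω : Set E3) (Ψ : E3 → Mat → ℝ) (α : E3 → ℝ) (r : ℝ) (u : E3 → E3) : ℝ :=
  ∫ x in innerSet Ω r, Ψ x (measConv (singularDeriv Ω u) (scaled α r) x)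

/-- The upscaled energy `I^{α_r}(g, G; Ω_r) = ∫_{Ω_r} Ψ(x, (μ * α_r)(x)) dx` with
`μ = (∇g - G) 𝓛³ + Dˢg`, of a general structured deformation `(g, G)`. -/
def upscaledEnergy (Ω : Set E3) (Ψ : E3 → Mat → ℝ) (α : E3 → ℝ) (r : ℝ)
    (g : E3 → E3) (G : E3 → Mat) : ℝ :=
  ∫ x in innerSet Ω r, Ψ x (fieldConv Ω (fun y => approxGrad Ω g y - G y) (scaled α r) x +
    measConv (singularDeriv Ω g) (scaled α r) x)

/-! ### Invertible and crystallographic structured deformations -/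

/-- The classical gradient `∇g(x)`, as a matrix. -/
def grad (g : E3 → E3) (x : E3) : Mat :=
  Matrix.of fun i j => fderiv ℝ g x (EuclideanSpace.single j 1) i

/-- `K_{(g,G)} = (∇g)⁻¹ G`. -/
def kTensor (g : E3 → E3) (G : E3 → Mat) (x : E3) : Mat := (grad g x)⁻¹ * G x

/-- The disarrangement tensor `M_{(g,G)} = ∇g - G`. -/
def disarrangement (g : E3 → E3) (G : E3 → Mat) (x : E3) : Mat := grad g x - G x

/-- `M_{(i,K_{(g,G)})}`, the disarrangement tensor of the purely submacroscopic part
`(i, K_{(g,G)})` of `(g, G)`, where `i` is the identity mapping. -/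
def subDisarrangement (g : E3 → E3) (G : E3 → Mat) (x : E3) : Mat :=
  disarrangement (fun y => y) (kTensor g G) x

/-- `g` is a diffeomorphism of class `C¹` of `Ω` onto an open set. -/
def IsC1Diffeo (Ω : Set E3) (g : E3 → E3) : Prop :=
  ContDiffOn ℝ 1 g Ω ∧ IsOpen (g '' Ω) ∧
    ∃ h : E3 → E3, ContDiffOn ℝ 1 h (g '' Ω) ∧ ∀ x ∈ Ω, h (g x) = x

/-- Invertible structured deformations, `ISD(Ω)`. -/
structure IsISD (Ω : Set E3) (g : E3 → E3) (G : E3 → Mat) : Prop where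
  sd : IsSD Ω g G
  diffeo : IsC1Diffeo Ω g
  lipschitz_grad : ∃ C, LipschitzOnWith C (grad g) Ω
  lipschitz_grad_inv : ∃ C, LipschitzOnWith C (fun x => (grad g x)⁻¹) Ω
  continuousOn : ContinuousOn G (closure Ω)
  invertible : ∀ x ∈ closure Ω, IsUnit (G x)
  det_eq : ∀ x ∈ Ω, (grad g x).det = (G x).det

/-- The dyad `s ⊗ m`. -/
def dyad (s m : E3) : Mat := Matrix.vecMulVec s.ofLp m.ofLp

/-- The vector product in `ℝ³`. -/
def cross (v w : E3) : E3 := WithLp.toLp 2 (crossProduct v.ofLp w.ofLp)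

/-- Slip systems of a single crystal: pairs of orthogonal unit vectors (slip direction `s a`, slip
plane normal `m a`), `a = 1, …, A`, with the slip periods `p a > 0`. -/
structure SlipSystems (A : ℕ) where
  s : Fin A → E3
  m : Fin A → E3
  p : Fin A → ℝ
  norm_s : ∀ a, ‖s a‖ = 1
  norm_m : ∀ a, ‖m a‖ = 1
  orthogonal : ∀ a, inner ℝ (s a) (m a) = 0
  p_pos : ∀ a, 0 < p a

/-- `(g, G)` is crystallographic: it is an invertible structured deformation whose disarrangements
`M_{(i,K_{(g,G)})}(x)` are linear combinations `∑ₐ γᵃ(x) sᵃ ⊗ mᵃ` of the slip dyads. -/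
structure IsCrystallographic {A : ℕ} (C : SlipSystems A) (Ω : Set E3) (g : E3 → E3)
    (G : E3 → Mat) : Prop where
  isd : IsISD Ω g G
  slips : ∃ γ : Fin A → E3 → ℝ, ∀ x ∈ Ω,
    subDisarrangement g G x = ∑ a, γ a x • dyad (C.s a) (C.m a)

/-- `v ⊗ mᵃ + ξ (mᵃ × mᵇ) ⊗ mᵇ`. -/
def slipMatrix {A : ℕ} (C : SlipSystems A) (a b : Fin A) (ξ : ℝ) (v : E3) : Mat :=
  dyad v (C.m a) + ξ • dyad (cross (C.m a) (C.m b)) (C.m b)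

/-- Periodicity along the slip planes: for all `a`, `b`, `ξ` the mapping
`v ↦ Φ(v ⊗ mᵃ + ξ (mᵃ × mᵇ) ⊗ mᵇ)` on the plane `{mᵃ}^⊥` has period `pᵃ sᵃ`. -/
def IsSlipPeriodic {A : ℕ} (C : SlipSystems A) (Φ : Mat → ℝ) : Prop :=
  ∀ (a b : Fin A) (ξ : ℝ) (v : E3), inner ℝ v (C.m a) = 0 → ∀ n : ℤ,
    Φ (slipMatrix C a b ξ (v + ((n : ℝ) * C.p a) • C.s a)) = Φ (slipMatrix C a b ξ v)

/-- Sublinear growth at infinity: `Φ(L) / |L| → 0` as `|L| → ∞`. -/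
def IsSublinear (Φ : Mat → ℝ) : Prop :=
  Tendsto (fun L : Mat => Φ L / ‖L‖) (comap (fun L : Mat => ‖L‖) atTop) (𝓝 0)

/-- `Ψ_g(x, L) = Ψ_i((∇g(x))⁻¹ L)`. -/
def psiG (Ψi : Mat → ℝ) (g : E3 → E3) (x : E3) (L : Mat) : ℝ := Ψi ((grad g x)⁻¹ * L)

/-- The bulk density `x ↦ Ψ_g(x, ∇g(x) - G(x))` of the localized energy. -/
def bulkDensity (Ψi : Mat → ℝ) (g : E3 → E3) (G : E3 → Mat) (x : E3) : ℝ :=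
  psiG Ψi g x (disarrangement g G x)

/-- The macroscopic deformation `Q g + c` seen by another observer. -/
def observedMap (Q : Mat) (c : E3) (g : E3 → E3) (x : E3) : E3 :=
  c + WithLp.toLp 2 (Q *ᵥ (g x).ofLp)

end SlipEnergy

end

/-!
The upscaled energy is continuous along admissible sequences because mollification turns weak-*
convergence into pointwise convergence. For `x ∈ Ω_r` the function `y ↦ α_r (x - y)` belongs to
`C₀(Ω)` (`isC0Test_kernelTest`), so `(Dˢu_n * α_r)(x)` converges to the mollification at `x` of the
limit measure. A weakly-* convergent sequence of measures is bounded by the Banach–Steinhaus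
theorem (`exists_bound_integral_of_tendsto`), hence these matrices are bounded uniformly in `n` and
`x`. As `Ψ_i` is Lipschitz and `(∇g)⁻¹` is bounded on `Ω`, the integrands are then bounded by a
constant (`exists_bound_psiG`) and dominated convergence applies (`tendsto_interfacialEnergy`).

In the limit measure the term `Dˢg` vanishes: by integration by parts the distributional derivative
of the `C¹` map `g` is `∇g 𝓛³` (`isDistribDeriv_withDensityᵥ_grad`), and a distributional derivative
is unique because a signed measure carried by `Ω` that annihilates all test functions on `Ω` is zero
(`eq_zero_of_integral_contDiff_eq_zero`).

Localization as `r → 0` is a second dominated convergence. Since `∇g - G` is bounded and continuous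
on `Ω`, its mollifications are bounded uniformly in `r` (`abs_fieldConv_scaled_le`) and converge to
it pointwise (`tendsto_fieldConv_scaled`), while every `x ∈ Ω` lies in `Ω_r` for small `r`.

The identities for the bulk density, its frame-indifference and its periodicity are matrix algebra:
`∇g` is invertible on `Ω`, because `det ∇g = det G ≠ 0`, so `(∇g)⁻¹ (∇g - G) = I - (∇g)⁻¹ G`.
-/

namespace SlipEnergy

open scoped NNReal

/-! ### Signed measures -/

section SignedMeasure

variable {X : Type*} [MeasurableSpace X]

instance isFiniteMeasure_variation (ν : SignedMeasure X) : IsFiniteMeasure ν.variation := by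
  rw [← SignedMeasure.totalVariation_eq_variation]
  unfold SignedMeasure.totalVariation
  infer_instance

theorem integral_toSignedMeasure_sub (μ₁ μ₂ : Measure X) [IsFiniteMeasure μ₁] [IsFiniteMeasure μ₂]
    {f : X → ℝ} (h₁ : Integrable f μ₁) (h₂ : Integrable f μ₂) :
    ∫ᵛ x, f x ∂•(μ₁.toSignedMeasure - μ₂.toSignedMeasure) = ∫ x, f x ∂μ₁ - ∫ x, f x ∂μ₂ := by
  have hflip : (ContinuousLinearMap.lsmul ℝ ℝ : ℝ →L[ℝ] ℝ →L[ℝ] ℝ) =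
      (ContinuousLinearMap.lsmul ℝ ℝ : ℝ →L[ℝ] ℝ →L[ℝ] ℝ).flip := by
    ext; simp
  have i₁ : μ₁.toSignedMeasure.Integrable f := by
    simpa [VectorMeasure.Integrable] using h₁
  have i₂ : μ₂.toSignedMeasure.Integrable f := by
    simpa [VectorMeasure.Integrable] using h₂
  rw [VectorMeasure.integral_sub_vectorMeasure i₁ i₂, hflip,
    VectorMeasure.integral_toSignedMeasure, VectorMeasure.integral_toSignedMeasure]

theorem integral_eq_integral_posPart_sub_negPart (ν : SignedMeasure X) {f : X → ℝ}
    (h₁ : Integrable f ν.toJordanDecomposition.posPart)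
    (h₂ : Integrable f ν.toJordanDecomposition.negPart) :
    ∫ᵛ x, f x ∂•ν = ∫ x, f x ∂ν.toJordanDecomposition.posPart -
      ∫ x, f x ∂ν.toJordanDecomposition.negPart := by
  rw [← integral_toSignedMeasure_sub _ _ h₁ h₂]
  congr 1
  exact ν.toSignedMeasure_toJordanDecomposition.symm

theorem integral_withDensityᵥ (μ : Measure X) {F : X → ℝ} (hF : Integrable F μ) {φ : X → ℝ}
    (hφm : Measurable φ) {C : ℝ} (hφ : ∀ x, ‖φ x‖ ≤ C) :
    ∫ᵛ x, φ x ∂•(μ.withDensityᵥ F) = ∫ x, φ x * F x ∂μ := by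
  have hfin : IsFiniteMeasure (μ.withDensity fun x => ENNReal.ofReal (F x)) :=
    isFiniteMeasure_withDensity_ofReal hF.2
  have hfin' : IsFiniteMeasure (μ.withDensity fun x => ENNReal.ofReal (-F x)) :=
    isFiniteMeasure_withDensity_ofReal hF.neg.2
  have hb : ∀ ρ : Measure X, IsFiniteMeasure ρ → Integrable φ ρ := fun ρ _ =>
    Integrable.of_bound hφm.aestronglyMeasurable C (ae_of_all _ hφ)
  rw [withDensityᵥ_eq_withDensity_pos_part_sub_withDensity_neg_part hF,
    integral_toSignedMeasure_sub _ _ (hb _ hfin) (hb _ hfin'),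
    integral_withDensity_eq_integral_toReal_smul₀ hF.1.aemeasurable.ennreal_ofReal
      (ae_of_all _ fun _ => ENNReal.ofReal_lt_top),
    integral_withDensity_eq_integral_toReal_smul₀
      (f := fun x => ENNReal.ofReal (-F x)) hF.1.aemeasurable.neg.ennreal_ofReal
      (ae_of_all _ fun _ => ENNReal.ofReal_lt_top), ← integral_sub]
  · refine integral_congr_ae (ae_of_all _ fun x => ?_)
    simp only [ENNReal.toReal_ofReal', smul_eq_mul]
    rcases le_total 0 (F x) with h | h
    · rw [max_eq_left h, max_eq_right (by simpa using h)]; ring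
    · rw [max_eq_right h, max_eq_left (by simpa using h)]; ring
  · exact (hF.pos_part.congr (ae_of_all _ fun x => (ENNReal.toReal_ofReal').symm)).mul_bdd
      (c := C) hφm.aestronglyMeasurable (ae_of_all _ hφ)
  · exact (hF.neg_part.congr (ae_of_all _ fun x => (ENNReal.toReal_ofReal').symm)).mul_bdd
      (c := C) hφm.aestronglyMeasurable (ae_of_all _ hφ)

/-- A signed measure carried by an open set `Ω` that annihilates all test functions on `Ω` is zero:
with respect to its total variation it has a density with values `±1`, and the fundamental lemma of
the calculus of variations shows that this density vanishes almost everywhere on `Ω`. -/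
theorem eq_zero_of_integral_contDiff_eq_zero {E : Type*} [NormedAddCommGroup E] [NormedSpace ℝ E]
    [FiniteDimensional ℝ E] [MeasurableSpace E] [BorelSpace E] {Ω : Set E} (hΩ : IsOpen Ω)
    (ν : SignedMeasure E) (hν : ∀ B, MeasurableSet B → Disjoint B Ω → ν B = 0)
    (h : ∀ φ : E → ℝ, ContDiff ℝ ∞ φ → HasCompactSupport φ → tsupport φ ⊆ Ω →
      ∫ᵛ x, φ x ∂•ν = 0) : ν = 0 := by
  classical
  set p := ν.toJordanDecomposition.posPart
  set q := ν.toJordanDecomposition.negPart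
  obtain ⟨s, hs, hps, hqs⟩ := ν.toJordanDecomposition.mutuallySingular
  change p s = 0 at hps
  change q sᶜ = 0 at hqs
  have hp1 : ∀ᵐ x ∂p, x ∉ s := measure_eq_zero_iff_ae_notMem.1 hps
  have hq1 : ∀ᵐ x ∂q, x ∈ s := by
    filter_upwards [measure_eq_zero_iff_ae_notMem.1 hqs] with x hx using by simpa using hx
  -- The polar density of `ν`: it is `1` where `ν` is positive and `-1` where `ν` is negative.
  let f : E → ℝ := fun x => if x ∈ s then -1 else 1
  have hfm : Measurable f := Measurable.ite hs measurable_const measurable_const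
  have hfb : ∀ x, ‖f x‖ ≤ 1 := fun x => by by_cases hx : x ∈ s <;> simp [f, hx]
  have hf : Integrable f (p + q) :=
    Integrable.of_bound hfm.aestronglyMeasurable 1 (ae_of_all _ hfb)
  have key := hΩ.ae_eq_zero_of_integral_contDiff_smul_eq_zero (μ := p + q)
    (hf.locallyIntegrable.locallyIntegrableOn _) (fun φ h1 h2 h3 => by
      have hφ : ∀ ρ : Measure E, IsFiniteMeasure ρ → Integrable φ ρ := fun ρ _ =>
        h1.continuous.integrable_of_hasCompactSupport h2
      have hφf : ∀ ρ : Measure E, IsFiniteMeasure ρ → Integrable (fun x => φ x • f x) ρ :=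
        fun ρ hρ => (hφ ρ hρ).mul_bdd (c := 1) hfm.aestronglyMeasurable (ae_of_all _ hfb)
      have h4 := h φ h1 h2 h3
      rw [integral_eq_integral_posPart_sub_negPart ν (hφ _ inferInstance)
        (hφ _ inferInstance)] at h4
      rw [integral_add_measure (hφf _ inferInstance) (hφf _ inferInstance), ← h4,
        sub_eq_add_neg, ← integral_neg]
      congr 1
      · refine integral_congr_ae ?_
        filter_upwards [hp1] with x hx
        simp [f, hx]
      · refine integral_congr_ae ?_
        filter_upwards [hq1] with x hx
        simp [f, hx])
  have hz : (p + q) Ω = 0 := by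
    rw [measure_eq_zero_iff_ae_notMem]
    filter_upwards [key] with x hx hxΩ
    have := hx hxΩ
    by_cases hxs : x ∈ s <;> simp [f, hxs] at this
  ext B hB
  have hd : ν B = ν (B ∩ Ω) + ν (B \ Ω) := by
    rw [← VectorMeasure.of_union (disjoint_sdiff_inter.symm) (hB.inter hΩ.measurableSet)
      (hB.diff hΩ.measurableSet), inter_union_sdiff]
  have h1 : ν (B ∩ Ω) = 0 := by
    have h2 := ν.enorm_le_totalVariation (B ∩ Ω)
    have h3 : ν.totalVariation (B ∩ Ω) = 0 := measure_mono_null inter_subset_right hz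
    rw [h3] at h2
    simpa using h2
  rw [hd, h1, hν _ (hB.diff hΩ.measurableSet) disjoint_sdiff_left]
  simp

end SignedMeasure

/-! ### The distributional derivative of a `C¹` map -/

/-- Integration by parts needs no regularity of `g` outside `Ω`, since it is only required at the
points of the support of the test function. -/
theorem isDistribDeriv_withDensityᵥ_grad {Ω : Set E3} (hΩ : IsOpen Ω) {g : E3 → E3}
    (hg : ContDiffOn ℝ 1 g Ω) (hgi : IntegrableOn g Ω)
    (hgrad : ∀ i j, IntegrableOn (fun x => grad g x i j) Ω) :
    IsDistribDeriv Ω g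
      (fun i j => volume.withDensityᵥ (Ω.indicator fun x => grad g x i j)) := by
  have hint : ∀ i j, Integrable (Ω.indicator fun x => grad g x i j) := fun i j =>
    (integrable_indicator_iff hΩ.measurableSet).2 (hgrad i j)
  refine ⟨fun i j B hB hd => ?_, fun φ h1 h2 h3 i j => ?_⟩
  · rw [withDensityᵥ_apply (hint i j) hB]
    refine setIntegral_eq_zero_of_forall_eq_zero fun x hx => ?_
    exact indicator_of_notMem (disjoint_left.1 hd hx) _
  · obtain ⟨C, hC⟩ := h2.exists_bound_of_continuous h1.continuous
    have h2' : HasCompactSupport (fun x => partialDeriv φ j x) :=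
      h2.fderiv_apply (𝕜 := ℝ) (EuclideanSpace.single j 1)
    have hc' : Continuous (fun x => partialDeriv φ j x) :=
      (h1.continuous_fderiv (by simp)).clm_apply continuous_const
    obtain ⟨C', hC'⟩ := h2'.exists_bound_of_continuous hc'
    have hφ0 : ∀ x, x ∉ Ω → φ x = 0 := fun x hx => image_eq_zero_of_notMem_tsupport
      fun h => hx (h3 h)
    have hφ0' : ∀ x, x ∉ Ω → partialDeriv φ j x = 0 := fun x hx => by
      have : fderiv ℝ φ x = 0 := fderiv_of_notMem_tsupport ℝ fun h => hx (h3 h)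
      simp [partialDeriv, this]
    have hd : ∀ x ∈ Ω, DifferentiableAt ℝ g x := fun x hx =>
      (hg.differentiableOn (by simp)).differentiableAt (hΩ.mem_nhds hx)
    have hgii : Integrable (Ω.indicator fun x => g x i) :=
      (integrable_indicator_iff hΩ.measurableSet).2
        ((EuclideanSpace.proj (𝕜 := ℝ) i).integrable_comp hgi)
    have hfd : ∀ x ∈ Ω, fderiv ℝ (fun x => g x i) x (EuclideanSpace.single j 1) =
        grad g x i j := fun x hx => by
      have : HasFDerivAt (fun x => g x i)
          ((EuclideanSpace.proj (𝕜 := ℝ) i).comp (fderiv ℝ g x)) x :=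
        (EuclideanSpace.proj (𝕜 := ℝ) i).hasFDerivAt.comp x (hd x hx).hasFDerivAt
      rw [this.fderiv]
      rfl
    have e1 : ∀ x, fderiv ℝ φ x (EuclideanSpace.single j 1) * g x i =
        (Ω.indicator fun x => g x i) x * partialDeriv φ j x := fun x => by
      by_cases hx : x ∈ Ω
      · simp [hx, partialDeriv, mul_comm]
      · have := hφ0' x hx
        unfold partialDeriv at this
        simp [hx, this]
    have e2 : ∀ x, φ x * fderiv ℝ (fun x => g x i) x (EuclideanSpace.single j 1) =
        φ x * Ω.indicator (fun x => grad g x i j) x := fun x => by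
      by_cases hx : x ∈ Ω
      · simp [hx, hfd x hx]
      · simp [hx, hφ0 x hx]
    have key := integral_mul_fderiv_eq_neg_fderiv_mul_of_integrable (μ := volume)
      (f := φ) (g := fun x => g x i) (v := EuclideanSpace.single j (1 : ℝ))
      ((hgii.mul_bdd (c := C') hc'.aestronglyMeasurable (ae_of_all _ hC')).congr
        (ae_of_all _ fun x => (e1 x).symm))
      (((hint i j).bdd_mul (c := C) h1.continuous.aestronglyMeasurable (ae_of_all _ hC)).congr
        (ae_of_all _ fun x => (e2 x).symm))
      ((hgii.mul_bdd (c := C) h1.continuous.aestronglyMeasurable (ae_of_all _ hC)).congr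
        (ae_of_all _ fun x => by
          by_cases hx : x ∈ Ω
          · simp [hx, mul_comm]
          · simp [hx, hφ0 x hx]))
      (fun x _ => (h1.differentiable (by simp)) x)
      (fun x hx => (EuclideanSpace.proj (𝕜 := ℝ) i).differentiableAt.comp x (hd x (h3 hx)))
    rw [integral_withDensityᵥ _ (hint i j) h1.continuous.measurable hC]
    simp only [e1, e2] at key
    rw [key, neg_neg, ← integral_indicator hΩ.measurableSet]
    refine integral_congr_ae (ae_of_all _ fun x => ?_)
    by_cases hx : x ∈ Ω <;> simp [hx]

/-- The distributional derivative on an open set is unique. -/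
theorem IsDistribDeriv.unique {Ω : Set E3} (hΩ : IsOpen Ω) {u : E3 → E3}
    {μ ν : Fin 3 → Fin 3 → SignedMeasure E3} (hμ : IsDistribDeriv Ω u μ)
    (hν : IsDistribDeriv Ω u ν) : μ = ν := by
  funext i j
  rw [← sub_eq_zero]
  refine eq_zero_of_integral_contDiff_eq_zero hΩ _ (fun B hB hd => ?_) fun φ h1 h2 h3 => ?_
  · simp [hμ.1 i j B hB hd, hν.1 i j B hB hd]
  · have hi : ∀ ρ : SignedMeasure E3, ρ.Integrable φ := fun ρ =>
      h1.continuous.integrable_of_hasCompactSupport h2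
    rw [VectorMeasure.integral_sub_vectorMeasure (hi _) (hi _), sub_eq_zero]
    exact neg_injective ((hμ.2 φ h1 h2 h3 i j).symm.trans (hν.2 φ h1 h2 h3 i j))

theorem distribDeriv_eq {Ω : Set E3} (hΩ : IsOpen Ω) {u : E3 → E3}
    {μ : Fin 3 → Fin 3 → SignedMeasure E3} (hμ : IsDistribDeriv Ω u μ) :
    distribDeriv Ω u = μ := by
  have h : ∃ μ, IsDistribDeriv Ω u μ := ⟨μ, hμ⟩
  rw [distribDeriv, dif_pos h]
  exact h.choose_spec.unique hΩ hμ

/-- A `C¹` map has no singular derivative. -/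
theorem singularDeriv_eq_zero_of_contDiffOn {Ω : Set E3} (hΩ : IsOpen Ω) {g : E3 → E3}
    (hg : ContDiffOn ℝ 1 g Ω) (hgi : IntegrableOn g Ω)
    (hgrad : ∀ i j, IntegrableOn (fun x => grad g x i j) Ω) (i j : Fin 3) :
    singularDeriv Ω g i j = 0 := by
  rw [singularDeriv, distribDeriv_eq hΩ (isDistribDeriv_withDensityᵥ_grad hΩ hg hgi hgrad)]
  exact (SignedMeasure.eq_singularPart 0 _ VectorMeasure.MutuallySingular.zero_left
    (zero_add _).symm).symm

theorem approxGrad_ae_eq_grad_of_contDiffOn {Ω : Set E3} (hΩ : IsOpen Ω) {g : E3 → E3}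
    (hg : ContDiffOn ℝ 1 g Ω) (hgi : IntegrableOn g Ω)
    (hgrad : ∀ i j, IntegrableOn (fun x => grad g x i j) Ω) :
    ∀ᵐ x ∂volume.restrict Ω, approxGrad Ω g x = grad g x := by
  have h : ∀ i j, ∀ᵐ x ∂volume.restrict Ω, approxGrad Ω g x i j = grad g x i j := fun i j => by
    have h1 := SignedMeasure.eq_rnDeriv (μ := volume)
      (s := volume.withDensityᵥ (Ω.indicator fun x => grad g x i j)) 0
      (Ω.indicator fun x => grad g x i j)
      ((integrable_indicator_iff hΩ.measurableSet).2 (hgrad i j))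
      VectorMeasure.MutuallySingular.zero_left (zero_add _).symm
    filter_upwards [ae_restrict_of_ae h1, ae_restrict_mem hΩ.measurableSet] with x hx hxΩ
    rw [approxGrad, distribDeriv_eq hΩ (isDistribDeriv_withDensityᵥ_grad hΩ hg hgi hgrad)]
    simpa [hxΩ] using hx.symm
  have h' := ae_all_iff.2 fun i => ae_all_iff.2 (h i)
  filter_upwards [h'] with x hx
  ext i j
  exact hx i j

/-! ### Inner sets and kernels -/

theorem ball_subset_of_mem_innerSet {Ω : Set E3} (hΩ : IsOpen Ω) {r : ℝ} (hr : 0 < r) {x : E3}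
    (hx : x ∈ innerSet Ω r) : ball x r ⊆ Ω := by
  refine (convex_ball x r).isPreconnected.subset_of_closure_inter_subset hΩ
    ⟨x, mem_ball_self hr, hx.1⟩ fun z hz => ?_
  -- The ball is connected, so it could leave `Ω` only through a boundary point.
  by_contra hzΩ
  have h1 : z ∈ frontier Ω := by
    rw [hΩ.frontier_eq]
    exact ⟨hz.1, hzΩ⟩
  have h2 := infDist_le_dist_of_mem (x := x) h1
  have h3 := mem_ball'.1 hz.2
  exact absurd hx.2 (by linarith)

theorem isOpen_innerSet {Ω : Set E3} (hΩ : IsOpen Ω) (r : ℝ) : IsOpen (innerSet Ω r) :=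
  hΩ.inter (isOpen_lt continuous_const (continuous_infDist_pt _))

theorem innerSet_subset (Ω : Set E3) (r : ℝ) : innerSet Ω r ⊆ Ω := fun _ hx => hx.1

theorem eventually_mem_innerSet {Ω : Set E3} (hΩ : IsOpen Ω) (hb : Bornology.IsBounded Ω)
    {x : E3} (hx : x ∈ Ω) : ∀ᶠ r in 𝓝[>] (0 : ℝ), x ∈ innerSet Ω r := by
  have hne : (frontier Ω).Nonempty := by
    refine nonempty_frontier_iff.2 ⟨⟨x, hx⟩, fun h => ?_⟩
    -- With an empty boundary `infDist` would be `0` and all inner sets would be empty.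
    rw [h] at hb
    exact NormedSpace.unbounded_univ ℝ E3 hb
  have hpos : 0 < infDist x (frontier Ω) := by
    refine (isClosed_frontier.notMem_iff_infDist_pos hne).1 fun h => ?_
    rw [hΩ.frontier_eq] at h
    exact h.2 hx
  filter_upwards [nhdsWithin_le_nhds (gt_mem_nhds hpos)] with r hr using ⟨hx, hr⟩

theorem IsKernel.continuous_scaled {α : E3 → ℝ} (hα : IsKernel α) (r : ℝ) :
    Continuous (scaled α r) := by
  have := hα.smooth.continuous
  unfold scaled
  fun_prop

theorem IsKernel.scaled_eq_zero {α : E3 → ℝ} (hα : IsKernel α) {r : ℝ} (hr : 0 < r) {z : E3}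
    (hz : r ≤ ‖z‖) : scaled α r z = 0 := by
  have : α (r⁻¹ • z) = 0 := image_eq_zero_of_notMem_tsupport fun h => by
    have h1 := mem_ball_zero_iff.1 (hα.support h)
    rw [norm_smul, norm_inv, Real.norm_of_nonneg hr.le, inv_mul_lt_one₀ hr] at h1
    linarith
  simp [scaled, this]

theorem IsKernel.hasCompactSupport {α : E3 → ℝ} (hα : IsKernel α) : HasCompactSupport α :=
  (isCompact_closedBall (0 : E3) 1).of_isClosed_subset (isClosed_tsupport α)
    (hα.support.trans ball_subset_closedBall)

theorem IsKernel.integrable {α : E3 → ℝ} (hα : IsKernel α) : Integrable α :=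
  hα.smooth.continuous.integrable_of_hasCompactSupport hα.hasCompactSupport

theorem IsKernel.exists_bound_scaled {α : E3 → ℝ} (hα : IsKernel α) (r : ℝ) :
    ∃ C, ∀ z, ‖scaled α r z‖ ≤ C := by
  obtain ⟨C, hC⟩ := hα.hasCompactSupport.exists_bound_of_continuous hα.smooth.continuous
  refine ⟨‖(r ^ 3)⁻¹‖ * C, fun z => ?_⟩
  rw [scaled, norm_mul]
  gcongr
  exact hC _

/-- The translate `y ↦ α_r (x - y)` of the reflected kernel, as an element of `C₀(ℝ³)`. -/
noncomputable def kernelTest {α : E3 → ℝ} (hα : IsKernel α) {r : ℝ} (hr : 0 < r) (x : E3) :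
    ZeroAtInftyContinuousMap E3 ℝ where
  toFun y := scaled α r (x - y)
  continuous_toFun := (hα.continuous_scaled r).comp (continuous_const.sub continuous_id)
  zero_at_infty' := by
    refine HasCompactSupport.is_zero_at_infty
      (HasCompactSupport.intro (isCompact_closedBall x r) fun y hy => ?_)
    refine hα.scaled_eq_zero hr ?_
    rw [mem_closedBall', dist_eq_norm] at hy
    exact (not_le.1 hy).le

@[simp]
theorem kernelTest_apply {α : E3 → ℝ} (hα : IsKernel α) {r : ℝ} (hr : 0 < r) (x y : E3) :
    kernelTest hα hr x y = scaled α r (x - y) := rfl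

theorem isC0Test_kernelTest {Ω : Set E3} (hΩ : IsOpen Ω) {α : E3 → ℝ} (hα : IsKernel α) {r : ℝ}
    (hr : 0 < r) {x : E3} (hx : x ∈ innerSet Ω r) : IsC0Test Ω (kernelTest hα hr x) :=
  fun y hy => hα.scaled_eq_zero hr <| by
    by_contra! h
    refine hy (ball_subset_of_mem_innerSet hΩ hr hx ?_)
    rwa [mem_ball', dist_eq_norm]

/-! ### Convolutions -/

theorem continuous_measConv (μ : Fin 3 → Fin 3 → SignedMeasure E3) {a : E3 → ℝ}
    (ha : Continuous a) {C : ℝ} (hC : ∀ z, ‖a z‖ ≤ C) : Continuous (measConv μ a) := by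
  refine continuous_pi fun i => continuous_pi fun j => ?_
  exact VectorMeasure.continuous_of_dominated (bound := fun _ => C)
    (fun x => (ha.comp (continuous_const.sub continuous_id)).aestronglyMeasurable)
    (fun x => ae_of_all _ fun y => hC _) (integrable_const C)
    (ae_of_all _ fun y => ha.comp (continuous_id.sub continuous_const))

theorem exists_bound_measConv (μ : Fin 3 → Fin 3 → SignedMeasure E3) {a : E3 → ℝ}
    {C : ℝ} (hC : ∀ z, ‖a z‖ ≤ C) : ∃ B, ∀ x i j, |measConv μ a x i j| ≤ B := by
  refine ⟨∑ i, ∑ j, C * ‖(ContinuousLinearMap.lsmul ℝ ℝ : ℝ →L[ℝ] ℝ →L[ℝ] ℝ)‖ *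
    (μ i j).variation.real univ, fun x i j => ?_⟩
  have hC0 : 0 ≤ C := (norm_nonneg _).trans (hC 0)
  have h1 : |measConv μ a x i j| ≤ C * ‖(ContinuousLinearMap.lsmul ℝ ℝ : ℝ →L[ℝ] ℝ →L[ℝ] ℝ)‖ *
      (μ i j).variation.real univ :=
    VectorMeasure.norm_integral_le_of_norm_le_const (μ := μ i j) (f := fun y => a (x - y))
      (B := ContinuousLinearMap.lsmul ℝ ℝ) (ae_of_all _ fun y => hC _)
  refine h1.trans ((Finset.single_le_sum (f := fun j => C *
    ‖(ContinuousLinearMap.lsmul ℝ ℝ : ℝ →L[ℝ] ℝ →L[ℝ] ℝ)‖ * (μ i j).variation.real univ)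
    (fun j _ => by positivity) (Finset.mem_univ j)).trans ?_)
  exact Finset.single_le_sum (f := fun i => ∑ j, C *
    ‖(ContinuousLinearMap.lsmul ℝ ℝ : ℝ →L[ℝ] ℝ →L[ℝ] ℝ)‖ * (μ i j).variation.real univ)
    (fun i _ => Finset.sum_nonneg fun j _ => by positivity) (Finset.mem_univ i)

theorem continuous_fieldConv {Ω : Set E3} {F : E3 → Mat}
    (hF : ∀ i j, IntegrableOn (fun x => F x i j) Ω) {a : E3 → ℝ} (ha : Continuous a) {C : ℝ}
    (hC : ∀ z, ‖a z‖ ≤ C) : Continuous (fieldConv Ω F a) := by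
  refine continuous_pi fun i => continuous_pi fun j => ?_
  refine MeasureTheory.continuous_of_dominated (bound := fun y => C * ‖F y i j‖)
    (fun x => (ha.comp (continuous_const.sub continuous_id)).aestronglyMeasurable.mul (hF i j).1)
    (fun x => ae_of_all _ fun y => ?_) ((hF i j).norm.const_mul C)
    (ae_of_all _ fun y => (ha.comp (continuous_id.sub continuous_const)).mul continuous_const)
  rw [norm_mul]
  gcongr
  exact hC _

/-- Rescaling the variable of integration turns the mollification of `F`, extended by zero
outside `Ω`, into an average against the fixed kernel `α`. -/
theorem fieldConv_scaled_apply {Ω : Set E3} (hΩ : IsOpen Ω) (F : E3 → Mat) (α : E3 → ℝ) {r : ℝ}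
    (hr : 0 < r) (x : E3) (i j : Fin 3) :
    fieldConv Ω F (scaled α r) x i j =
      ∫ z, α z * Ω.indicator (fun y => F y i j) (x - r • z) := by
  have h1 : fieldConv Ω F (scaled α r) x i j =
      ∫ y, scaled α r (x - y) * Ω.indicator (fun y => F y i j) y := by
    change ∫ y in Ω, scaled α r (x - y) * F y i j = _
    rw [← integral_indicator hΩ.measurableSet]
    refine integral_congr_ae (ae_of_all _ fun y => ?_)
    by_cases hy : y ∈ Ω <;> simp [hy]
  have h2 : ∫ y, scaled α r (x - y) * Ω.indicator (fun y => F y i j) y =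
      ∫ w, scaled α r w * Ω.indicator (fun y => F y i j) (x - w) := by
    rw [← integral_sub_left_eq_self (fun w => scaled α r w *
      Ω.indicator (fun y => F y i j) (x - w)) volume x]
    simp
  have h3 := Measure.integral_comp_inv_smul_of_nonneg (volume : Measure E3)
    (fun z => α z * Ω.indicator (fun y => F y i j) (x - r • z)) hr.le
  rw [h1, h2]
  have h4 : ∀ w, scaled α r w * Ω.indicator (fun y => F y i j) (x - w) =
      (r ^ 3)⁻¹ * (α (r⁻¹ • w) * Ω.indicator (fun y => F y i j) (x - r • r⁻¹ • w)) := fun w => by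
    rw [smul_inv_smul₀ hr.ne', scaled, mul_assoc]
  simp only [h4]
  rw [integral_const_mul, h3, finrank_euclideanSpace, Fintype.card_fin, smul_eq_mul,
    inv_mul_cancel_left₀ (by positivity)]

theorem abs_fieldConv_scaled_le {Ω : Set E3} (hΩ : IsOpen Ω) {F : E3 → Mat} {B : ℝ}
    (hB0 : 0 ≤ B) (hB : ∀ x ∈ Ω, ∀ i j, |F x i j| ≤ B) {α : E3 → ℝ} (hα : IsKernel α) {r : ℝ}
    (hr : 0 < r) (x : E3) (i j : Fin 3) :
    |fieldConv Ω F (scaled α r) x i j| ≤ (∫ z, |α z|) * B := by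
  rw [fieldConv_scaled_apply hΩ F α hr, ← integral_mul_const, ← Real.norm_eq_abs]
  refine norm_integral_le_of_norm_le (hα.integrable.abs.mul_const B) (ae_of_all _ fun z => ?_)
  rw [norm_mul, Real.norm_eq_abs]
  gcongr
  by_cases hz : x - r • z ∈ Ω
  · simpa [hz] using hB _ hz i j
  · simpa [hz] using hB0

/-- Mollifications of a bounded field converge at its points of continuity. -/
theorem tendsto_fieldConv_scaled {Ω : Set E3} (hΩ : IsOpen Ω) {F : E3 → Mat}
    (hF : ContinuousOn F Ω) {B : ℝ} (hB0 : 0 ≤ B) (hB : ∀ x ∈ Ω, ∀ i j, |F x i j| ≤ B)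
    {α : E3 → ℝ} (hα : IsKernel α) {x : E3} (hx : x ∈ Ω) :
    Tendsto (fun r => fieldConv Ω F (scaled α r) x) (𝓝[>] 0) (𝓝 (F x)) := by
  refine tendsto_pi_nhds.2 fun i => tendsto_pi_nhds.2 fun j => ?_
  have hFij : ContinuousOn (fun y => F y i j) Ω := fun y hy =>
    ((continuous_apply j).tendsto _).comp (((continuous_apply i).tendsto _).comp (hF y hy))
  have hm : Measurable (Ω.indicator fun y => F y i j) :=
    measurable_of_isOpen fun s hs => by
      classical
      exact hFij.measurable_piecewise continuousOn_const hΩ.measurableSet hs.measurableSet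
  have h1 : Tendsto (fun r : ℝ => ∫ z, α z * Ω.indicator (fun y => F y i j) (x - r • z)) (𝓝[>] 0)
      (𝓝 (∫ z, α z * F x i j)) := by
    refine tendsto_integral_filter_of_dominated_convergence (fun z => |α z| * B)
      (Eventually.of_forall fun r => ?_) (Eventually.of_forall fun r => ae_of_all _ fun z => ?_)
      (hα.integrable.abs.mul_const B) (ae_of_all _ fun z => ?_)
    · exact hα.smooth.continuous.aestronglyMeasurable.mul
        (hm.comp (by fun_prop)).aestronglyMeasurable
    · rw [norm_mul, Real.norm_eq_abs]
      gcongr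
      by_cases hz : x - r • z ∈ Ω
      · simpa [hz] using hB _ hz i j
      · simpa [hz] using hB0
    · refine Tendsto.const_mul _ ?_
      have hz : Tendsto (fun r : ℝ => x - r • z) (𝓝[>] 0) (𝓝 x) := by
        have : Continuous (fun r : ℝ => x - r • z) := by fun_prop
        simpa using (this.tendsto 0).mono_left nhdsWithin_le_nhds
      refine ((hFij.continuousAt (hΩ.mem_nhds hx)).tendsto.comp hz).congr' ?_
      filter_upwards [hz (hΩ.mem_nhds hx)] with r hr
      exact (indicator_of_mem hr _).symm
  rw [integral_mul_const, hα.integral_one, one_mul] at h1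
  refine h1.congr' ?_
  filter_upwards [self_mem_nhdsWithin] with r hr
  exact (fieldConv_scaled_apply hΩ F α hr x i j).symm

/-! ### Weak-* convergent sequences of measures -/

/-- `C₀(Ω)`, as the subspace of `C₀(ℝ³)` of the functions that vanish outside `Ω`. -/
noncomputable def c0Submodule (Ω : Set E3) : Submodule ℝ (ZeroAtInftyContinuousMap E3 ℝ) where
  carrier := {φ | IsC0Test Ω φ}
  add_mem' hφ hψ x hx := by simp [hφ x hx, hψ x hx]
  zero_mem' x _ := rfl
  smul_mem' c φ hφ x hx := by simp [hφ x hx]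

theorem isClosed_c0Submodule (Ω : Set E3) :
    IsClosed (c0Submodule Ω : Set (ZeroAtInftyContinuousMap E3 ℝ)) := by
  have : (c0Submodule Ω : Set (ZeroAtInftyContinuousMap E3 ℝ)) =
      ⋂ x ∈ Ωᶜ, {φ | φ x = 0} := by
    ext φ
    simp [c0Submodule, IsC0Test]
  rw [this]
  refine isClosed_biInter fun x _ => isClosed_eq ?_ continuous_const
  exact (continuous_eval_const (F := BoundedContinuousFunction E3 ℝ) x).comp
    (ZeroAtInftyContinuousMap.isometry_toBCF).continuous

theorem norm_apply_le_norm (φ : ZeroAtInftyContinuousMap E3 ℝ) (x : E3) : ‖φ x‖ ≤ ‖φ‖ :=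
  φ.toBCF.norm_coe_le_norm x

theorem integrable_zeroAtInfty (ν : SignedMeasure E3) (φ : ZeroAtInftyContinuousMap E3 ℝ) :
    ν.Integrable φ :=
  Integrable.of_bound φ.continuous.aestronglyMeasurable ‖φ‖ (ae_of_all _ (norm_apply_le_norm φ))

theorem norm_integral_zeroAtInfty_le (ν : SignedMeasure E3) (φ : ZeroAtInftyContinuousMap E3 ℝ) :
    ‖∫ᵛ x, φ x ∂•ν‖ ≤
      ‖(ContinuousLinearMap.lsmul ℝ ℝ : ℝ →L[ℝ] ℝ →L[ℝ] ℝ)‖ * ν.variation.real univ * ‖φ‖ := by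
  refine (VectorMeasure.norm_integral_le_of_norm_le_const (μ := ν) (f := fun x => φ x)
    (B := ContinuousLinearMap.lsmul ℝ ℝ) (ae_of_all _ (norm_apply_le_norm φ))).trans_eq ?_
  ring

/-- Integration against a signed measure, as a continuous linear functional on `C₀(ℝ³)`. -/
noncomputable def integralZeroAtInfty (ν : SignedMeasure E3) :
    ZeroAtInftyContinuousMap E3 ℝ →L[ℝ] ℝ :=
  LinearMap.mkContinuous
    { toFun := fun φ : ZeroAtInftyContinuousMap E3 ℝ => ∫ᵛ x, φ x ∂•ν
      map_add' := fun φ ψ : ZeroAtInftyContinuousMap E3 ℝ =>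
        VectorMeasure.integral_fun_add (f := fun x => φ x) (g := fun x => ψ x)
          (integrable_zeroAtInfty ν φ) (integrable_zeroAtInfty ν ψ)
      map_smul' := fun _ _ => VectorMeasure.integral_fun_smul .. }
    (‖(ContinuousLinearMap.lsmul ℝ ℝ : ℝ →L[ℝ] ℝ →L[ℝ] ℝ)‖ * ν.variation.real univ)
    (norm_integral_zeroAtInfty_le ν)

/-- The Banach–Steinhaus theorem on a closed subspace. -/
theorem exists_bound_on_submodule {E : Type*} [NormedAddCommGroup E] [NormedSpace ℝ E]
    [CompleteSpace E] {W : Submodule ℝ E} (hW : IsClosed (W : Set E)) (T : ℕ → E →L[ℝ] ℝ)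
    (h : ∀ x ∈ W, ∃ C, ∀ n, ‖T n x‖ ≤ C) :
    ∃ M : ℝ, 0 ≤ M ∧ ∀ n, ∀ x ∈ W, ‖T n x‖ ≤ M * ‖x‖ := by
  have : CompleteSpace W := hW.completeSpace_coe
  obtain ⟨M, hM⟩ := banach_steinhaus (g := fun n => (T n).comp W.subtypeL) fun x => h x.1 x.2
  exact ⟨M, (norm_nonneg _).trans (hM 0), fun n x hx =>
    (((T n).comp W.subtypeL).le_opNorm ⟨x, hx⟩).trans
      (mul_le_mul_of_nonneg_right (hM n) (norm_nonneg x))⟩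

/-- A sequence of measures that converges weakly-* on `Ω` is bounded as functionals on `C₀(Ω)`. -/
theorem exists_bound_integral_of_tendsto {Ω : Set E3} {ν : ℕ → SignedMeasure E3}
    (h : ∀ φ : ZeroAtInftyContinuousMap E3 ℝ, IsC0Test Ω φ →
      ∃ l : ℝ, Tendsto (fun n => ∫ᵛ x, φ x ∂•(ν n)) atTop (𝓝 l)) :
    ∃ M : ℝ, 0 ≤ M ∧ ∀ n, ∀ φ : ZeroAtInftyContinuousMap E3 ℝ, IsC0Test Ω φ →
      |∫ᵛ x, φ x ∂•(ν n)| ≤ M * ‖φ‖ := by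
  refine exists_bound_on_submodule (isClosed_c0Submodule Ω) (fun n => integralZeroAtInfty (ν n))
    fun φ hφ => ?_
  obtain ⟨l, hl⟩ := h φ hφ
  obtain ⟨C, hC⟩ := hl.norm.bddAbove_range
  exact ⟨C, fun n => hC (mem_range_self n)⟩

/-! ### Matrices -/

theorem abs_apply_le_frobenius_norm (L : Mat) (i j : Fin 3) : |L i j| ≤ ‖L‖ := by
  rw [Matrix.frobenius_norm_def, ← Real.sqrt_eq_rpow]
  refine Real.abs_le_sqrt ?_
  simp only [Real.rpow_two, Real.norm_eq_abs, sq_abs]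
  exact (Finset.single_le_sum (f := fun j => L i j ^ 2) (fun j _ => sq_nonneg _)
    (Finset.mem_univ j)).trans (Finset.single_le_sum (f := fun i => ∑ j, L i j ^ 2)
    (fun i _ => Finset.sum_nonneg fun j _ => sq_nonneg _) (Finset.mem_univ i))

theorem frobenius_norm_le_of_abs_apply_le {L : Mat} {B : ℝ} (hB0 : 0 ≤ B)
    (h : ∀ i j, |L i j| ≤ B) : ‖L‖ ≤ 3 * B := by
  rw [Matrix.frobenius_norm_def, ← Real.sqrt_eq_rpow]
  refine Real.sqrt_le_iff.2 ⟨by positivity, ?_⟩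
  simp only [Real.rpow_two, Real.norm_eq_abs]
  calc ∑ i, ∑ j, |L i j| ^ 2 ≤ ∑ i : Fin 3, ∑ j : Fin 3, B ^ 2 := by
        gcongr with i _ j _
        exact h i j
    _ = (3 * B) ^ 2 := by simp; ring

theorem exists_norm_le_of_lipschitzOnWith {Ω : Set E3} (hb : Bornology.IsBounded Ω) {K : ℝ≥0}
    {F : E3 → Mat} (hF : LipschitzOnWith K F Ω) : ∃ B, 0 ≤ B ∧ ∀ x ∈ Ω, ‖F x‖ ≤ B := by
  rcases Ω.eq_empty_or_nonempty with rfl | ⟨x₀, hx₀⟩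
  · exact ⟨0, le_rfl, by simp⟩
  refine ⟨‖F x₀‖ + K * diam Ω, by positivity, fun x hx => ?_⟩
  have h1 := hF.dist_le_mul x hx x₀ hx₀
  have h2 := dist_le_diam_of_mem hb hx hx₀
  calc ‖F x‖ ≤ ‖F x₀‖ + dist (F x) (F x₀) := by
        rw [dist_eq_norm]
        exact norm_le_norm_add_norm_sub' _ _
    _ ≤ _ := by gcongr; exact h1.trans (by gcongr)

/-! ### The density `Ψ_g` -/

theorem exists_bound_psiG {Ω : Set E3} {Ψi : Mat → ℝ} {K : ℝ≥0} (hLip : LipschitzWith K Ψi)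
    {g : E3 → E3} {N : ℝ} (hN : ∀ x ∈ Ω, ‖(grad g x)⁻¹‖ ≤ N) (B : ℝ) :
    ∃ D, ∀ x ∈ Ω, ∀ L : Mat, (∀ i j, |L i j| ≤ B) → ‖psiG Ψi g x L‖ ≤ D := by
  refine ⟨‖Ψi 0‖ + K * (N * (3 * B)), fun x hx L hL => ?_⟩
  have hB0 : 0 ≤ B := (abs_nonneg _).trans (hL 0 0)
  have hN0 : 0 ≤ N := (norm_nonneg _).trans (hN x hx)
  have h1 := hLip.dist_le_mul ((grad g x)⁻¹ * L) 0
  rw [dist_zero_right] at h1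
  calc ‖psiG Ψi g x L‖ ≤ ‖Ψi 0‖ + dist (Ψi ((grad g x)⁻¹ * L)) (Ψi 0) := by
        rw [dist_eq_norm]
        exact norm_le_norm_add_norm_sub' _ _
    _ ≤ _ := by
        gcongr
        refine h1.trans ?_
        gcongr
        refine (Matrix.frobenius_norm_mul _ _).trans ?_
        gcongr
        · exact hN x hx
        · exact frobenius_norm_le_of_abs_apply_le hB0 hL

theorem continuous_psiG {Ψi : Mat → ℝ} (hΨ : Continuous Ψi) (g : E3 → E3) (x : E3) :
    Continuous (psiG Ψi g x) :=
  hΨ.comp (continuous_const.matrix_mul continuous_id)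

theorem continuousOn_psiG {Ψi : Mat → ℝ} (hΨ : Continuous Ψi) {g : E3 → E3} {S : Set E3}
    (hg : ContinuousOn (fun x => (grad g x)⁻¹) S) {L : E3 → Mat} (hL : ContinuousOn L S) :
    ContinuousOn (fun x => psiG Ψi g x (L x)) S := by
  refine hΨ.comp_continuousOn ?_
  have h : Continuous fun p : Mat × Mat => p.1 * p.2 :=
    continuous_fst.matrix_mul continuous_snd
  exact h.comp_continuousOn (hg.prodMk hL)

theorem integrableOn_psiG {Ω S : Set E3} (hb : Bornology.IsBounded Ω) (hS : IsOpen S)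
    (hSΩ : S ⊆ Ω) {Ψi : Mat → ℝ} {K : ℝ≥0} (hLip : LipschitzWith K Ψi) {g : E3 → E3}
    (hg : ContinuousOn (fun x => (grad g x)⁻¹) Ω) {N : ℝ} (hN : ∀ x ∈ Ω, ‖(grad g x)⁻¹‖ ≤ N)
    {L : E3 → Mat} (hL : ContinuousOn L S) {B : ℝ} (hB : ∀ x ∈ S, ∀ i j, |L x i j| ≤ B) :
    IntegrableOn (fun x => psiG Ψi g x (L x)) S := by
  obtain ⟨D, hD⟩ := exists_bound_psiG hLip hN B
  refine IntegrableOn.of_bound ((hb.subset hSΩ).measure_lt_top)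
    ((continuousOn_psiG hLip.continuous (hg.mono hSΩ) hL).aestronglyMeasurable hS.measurableSet)
    D ?_
  filter_upwards [ae_restrict_mem hS.measurableSet] with x hx
  exact hD x (hSΩ hx) _ (hB x hx)

/-! ### Admissible sequences -/

/-- Along an admissible sequence the mollified singular parts converge pointwise on `Ω_r`, and they
are uniformly bounded by the Banach–Steinhaus theorem. Dominated convergence concludes. -/
theorem tendsto_interfacialEnergy {Ω : Set E3} (hΩ : IsOpen Ω) (hb : Bornology.IsBounded Ω)
    {Ψi : Mat → ℝ} {K : ℝ≥0} (hLip : LipschitzWith K Ψi) {α : E3 → ℝ} (hα : IsKernel α)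
    {g : E3 → E3} {G : E3 → Mat} (hg : ContinuousOn (fun x => (grad g x)⁻¹) Ω) {N : ℝ}
    (hN : ∀ x ∈ Ω, ‖(grad g x)⁻¹‖ ≤ N) {r : ℝ} (hr : 0 < r) {u : ℕ → E3 → E3}
    (hu : IsAdmissible Ω g G u) :
    Tendsto (fun n => interfacialEnergy Ω (psiG Ψi g) α r (u n)) atTop
      (𝓝 (upscaledEnergy Ω (psiG Ψi g) α r g G)) := by
  obtain ⟨C, hC⟩ := hα.exists_bound_scaled r
  have hC0 : 0 ≤ C := (norm_nonneg _).trans (hC 0)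
  have hM : ∀ i j, ∃ M : ℝ, 0 ≤ M ∧ ∀ n, ∀ φ : ZeroAtInftyContinuousMap E3 ℝ, IsC0Test Ω φ →
      |∫ᵛ x, φ x ∂•(singularDeriv Ω (u n) i j)| ≤ M * ‖φ‖ := fun i j =>
    exists_bound_integral_of_tendsto fun φ hφ => ⟨_, hu.tendsto_singular i j φ hφ⟩
  choose M hM0 hM using hM
  have hnorm : ∀ x, ‖kernelTest hα hr x‖ ≤ C := fun x =>
    (BoundedContinuousFunction.norm_le hC0).2 fun y => hC _
  have hbound : ∀ n, ∀ x ∈ innerSet Ω r, ∀ i j,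
      |measConv (singularDeriv Ω (u n)) (scaled α r) x i j| ≤ ∑ i, ∑ j, M i j * C := by
    intro n x hx i j
    have h1 : |measConv (singularDeriv Ω (u n)) (scaled α r) x i j| ≤ M i j * C :=
      (hM i j n _ (isC0Test_kernelTest hΩ hα hr hx)).trans
        (mul_le_mul_of_nonneg_left (hnorm x) (hM0 i j))
    exact h1.trans ((Finset.single_le_sum (f := fun j => M i j * C)
      (fun j _ => mul_nonneg (hM0 i j) hC0) (Finset.mem_univ j)).trans
      (Finset.single_le_sum (f := fun i => ∑ j, M i j * C)
        (fun i _ => Finset.sum_nonneg fun j _ => mul_nonneg (hM0 i j) hC0) (Finset.mem_univ i)))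
  obtain ⟨D, hD⟩ := exists_bound_psiG hLip hN (∑ i, ∑ j, M i j * C)
  have hS := isOpen_innerSet hΩ r
  have hSΩ := innerSet_subset Ω r
  refine tendsto_integral_of_dominated_convergence (fun _ => D) (fun n => ?_) ?_ (fun n => ?_) ?_
  · exact (continuousOn_psiG hLip.continuous (hg.mono hSΩ)
      (continuous_measConv _ (hα.continuous_scaled r) hC).continuousOn).aestronglyMeasurable
      hS.measurableSet
  · exact integrableOn_const (hb.subset hSΩ).measure_lt_top.ne
  · filter_upwards [ae_restrict_mem hS.measurableSet] with x hx
    exact hD x (hSΩ hx) _ (hbound n x hx)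
  · filter_upwards [ae_restrict_mem hS.measurableSet] with x hx
    refine ((continuous_psiG hLip.continuous g x).tendsto _).comp ?_
    refine tendsto_pi_nhds.2 fun i => tendsto_pi_nhds.2 fun j => ?_
    change Tendsto (fun n => ∫ᵛ y, scaled α r (x - y) ∂•(singularDeriv Ω (u n) i j)) atTop
      (𝓝 ((∫ y in Ω, scaled α r (x - y) * (approxGrad Ω g y - G y) i j) +
        ∫ᵛ y, scaled α r (x - y) ∂•(singularDeriv Ω g i j)))
    simpa only [kernelTest_apply] using hu.tendsto_singular i j _ (isC0Test_kernelTest hΩ hα hr hx)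

/-! ### Spatial localization -/

/-- The energies of the mollifications of a bounded continuous field `F` on `Ω` converge to the
energy of `F`. -/
theorem tendsto_integral_psiG_fieldConv {Ω : Set E3} (hΩ : IsOpen Ω)
    (hb : Bornology.IsBounded Ω) {Ψi : Mat → ℝ} {K : ℝ≥0} (hLip : LipschitzWith K Ψi)
    {α : E3 → ℝ} (hα : IsKernel α) {g : E3 → E3}
    (hg : ContinuousOn (fun x => (grad g x)⁻¹) Ω) {N : ℝ} (hN : ∀ x ∈ Ω, ‖(grad g x)⁻¹‖ ≤ N)
    {F : E3 → Mat} (hF : ContinuousOn F Ω) {B : ℝ} (hB0 : 0 ≤ B)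
    (hB : ∀ x ∈ Ω, ∀ i j, |F x i j| ≤ B) (hFi : ∀ i j, IntegrableOn (fun x => F x i j) Ω) :
    Tendsto (fun r => ∫ x in innerSet Ω r, psiG Ψi g x (fieldConv Ω F (scaled α r) x)) (𝓝[>] 0)
      (𝓝 (∫ x in Ω, psiG Ψi g x (F x))) := by
  obtain ⟨D, hD⟩ := exists_bound_psiG hLip hN ((∫ z, |α z|) * B)
  have hbd : ∀ r : ℝ, 0 < r → ∀ x ∈ Ω, ‖psiG Ψi g x (fieldConv Ω F (scaled α r) x)‖ ≤ D :=
    fun r hr x hx => hD x hx _ fun i j => abs_fieldConv_scaled_le hΩ hB0 hB hα hr x i j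
  have h1 : ∀ r, ∫ x in innerSet Ω r, psiG Ψi g x (fieldConv Ω F (scaled α r) x) =
      ∫ x in Ω, (innerSet Ω r).indicator
        (fun x => psiG Ψi g x (fieldConv Ω F (scaled α r) x)) x := fun r => by
    rw [setIntegral_indicator (isOpen_innerSet hΩ r).measurableSet,
      inter_eq_right.2 (innerSet_subset Ω r)]
  simp only [h1]
  refine tendsto_integral_filter_of_dominated_convergence (fun _ => D) ?_ ?_
    (integrableOn_const hb.measure_lt_top.ne) ?_
  · refine Eventually.of_forall fun r => ?_
    obtain ⟨C, hC⟩ := hα.exists_bound_scaled r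
    exact ((continuousOn_psiG hLip.continuous hg (continuous_fieldConv hFi
      (hα.continuous_scaled r) hC).continuousOn).aestronglyMeasurable hΩ.measurableSet).indicator
      (isOpen_innerSet hΩ r).measurableSet
  · filter_upwards [self_mem_nhdsWithin] with r hr
    filter_upwards [ae_restrict_mem hΩ.measurableSet] with x hx
    exact (norm_indicator_le_norm_self
      (fun x => psiG Ψi g x (fieldConv Ω F (scaled α r) x)) x).trans (hbd r hr x hx)
  · filter_upwards [ae_restrict_mem hΩ.measurableSet] with x hx
    refine (((continuous_psiG hLip.continuous g x).tendsto _).comp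
      (tendsto_fieldConv_scaled hΩ hF hB0 hB hα hx)).congr' ?_
    filter_upwards [eventually_mem_innerSet hΩ hb hx] with r hr
    exact (indicator_of_mem hr fun x => psiG Ψi g x (fieldConv Ω F (scaled α r) x)).symm

/-! ### Pointwise identities for invertible structured deformations -/

theorem subDisarrangement_eq (g : E3 → E3) (G : E3 → Mat) (x : E3) :
    subDisarrangement g G x = 1 - kTensor g G x := by
  have : grad (fun y => y) x = 1 := by
    ext i j
    simp [grad, Matrix.one_apply]
  rw [subDisarrangement, disarrangement, this]

theorem IsISD.isUnit_det_grad {Ω : Set E3} {g : E3 → E3} {G : E3 → Mat} (h : IsISD Ω g G)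
    {x : E3} (hx : x ∈ Ω) : IsUnit (grad g x).det := by
  rw [h.det_eq x hx]
  exact (Matrix.isUnit_iff_isUnit_det _).1 (h.invertible x (subset_closure hx))

theorem IsISD.psiG_disarrangement {Ω : Set E3} {g : E3 → E3} {G : E3 → Mat} (h : IsISD Ω g G)
    (Ψi : Mat → ℝ) {x : E3} (hx : x ∈ Ω) :
    psiG Ψi g x (grad g x - G x) = Ψi (1 - (grad g x)⁻¹ * G x) := by
  rw [psiG, mul_sub, Matrix.nonsing_inv_mul _ (h.isUnit_det_grad hx)]

theorem IsISD.bulkDensity_eq {Ω : Set E3} {g : E3 → E3} {G : E3 → Mat} (h : IsISD Ω g G)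
    (Ψi : Mat → ℝ) {x : E3} (hx : x ∈ Ω) :
    bulkDensity Ψi g G x = Ψi (subDisarrangement g G x) := by
  rw [subDisarrangement_eq]
  exact h.psiG_disarrangement Ψi hx

theorem grad_observedMap (Q : Mat) (c : E3) {g : E3 → E3} {x : E3}
    (hg : DifferentiableAt ℝ g x) : grad (observedMap Q c g) x = Q * grad g x := by
  have h1 : HasFDerivAt (observedMap Q c g)
      ((LinearMap.toContinuousLinearMap (Matrix.toLpLin 2 2 Q)).comp (fderiv ℝ g x)) x :=
    ((LinearMap.toContinuousLinearMap (Matrix.toLpLin 2 2 Q)).hasFDerivAt.comp x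
      hg.hasFDerivAt).const_add c
  ext i j
  simp only [grad, Matrix.of_apply, h1.fderiv, Matrix.mul_apply]
  simp [Matrix.toLpLin_apply, Matrix.mulVec, dotProduct]

theorem bulkDensity_observedMap (Ψi : Mat → ℝ) {Q : Mat}
    (hQ : Q ∈ Matrix.specialOrthogonalGroup (Fin 3) ℝ) (c : E3) {g : E3 → E3} {x : E3}
    (hg : DifferentiableAt ℝ g x) (G : E3 → Mat) :
    bulkDensity Ψi (observedMap Q c g) (fun y => Q * G y) x = bulkDensity Ψi g G x := by
  have hdet : IsUnit Q.det := by
    rw [(Matrix.mem_specialOrthogonalGroup_iff.1 hQ).2]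
    exact isUnit_one
  simp only [bulkDensity, psiG, disarrangement, grad_observedMap Q c hg]
  rw [← mul_sub, Matrix.mul_inv_rev, mul_assoc, Matrix.nonsing_inv_mul_cancel_left _ _ hdet]

end SlipEnergy

theorem mainTheorem7 {A : ℕ} (C : SlipEnergy.SlipSystems A)
    (Ω : Set SlipEnergy.E3) (hΩ : SlipEnergy.IsLipschitzDomain Ω)
    (Ψi : SlipEnergy.Mat → ℝ) (hLip : ∃ K, LipschitzWith K Ψi)
    (hsub : SlipEnergy.IsSublinear Ψi) (hper : SlipEnergy.IsSlipPeriodic C Ψi)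
    (α : SlipEnergy.E3 → ℝ) (hα : SlipEnergy.IsKernel α)
    (g : SlipEnergy.E3 → SlipEnergy.E3) (G : SlipEnergy.E3 → SlipEnergy.Mat)
    (hgG : SlipEnergy.IsCrystallographic C Ω g G) :
    -- the averaged interfacial energy is well defined
    (∀ r : ℝ, 0 < r → ∀ u : SlipEnergy.E3 → SlipEnergy.E3, SlipEnergy.IsSBV Ω u →
      IntegrableOn (fun x => SlipEnergy.psiG Ψi g x
        (SlipEnergy.measConv (SlipEnergy.singularDeriv Ω u) (SlipEnergy.scaled α r) x))
        (SlipEnergy.innerSet Ω r)) ∧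
    -- the upscaled energy is the limit along every admissible sequence ...
    (∀ r : ℝ, 0 < r → ∀ u : ℕ → SlipEnergy.E3 → SlipEnergy.E3, SlipEnergy.IsAdmissible Ω g G u →
      Tendsto (fun n => SlipEnergy.interfacialEnergy Ω (SlipEnergy.psiG Ψi g) α r (u n)) atTop
        (𝓝 (SlipEnergy.upscaledEnergy Ω (SlipEnergy.psiG Ψi g) α r g G))) ∧
    -- ... and has the stated form
    (∀ r : ℝ, 0 < r →
      IntegrableOn (fun x => SlipEnergy.psiG Ψi g x (SlipEnergy.fieldConv Ω
        (fun y => SlipEnergy.grad g y - G y) (SlipEnergy.scaled α r) x))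
        (SlipEnergy.innerSet Ω r) ∧
      SlipEnergy.upscaledEnergy Ω (SlipEnergy.psiG Ψi g) α r g G =
        ∫ x in SlipEnergy.innerSet Ω r, SlipEnergy.psiG Ψi g x (SlipEnergy.fieldConv Ω
          (fun y => SlipEnergy.grad g y - G y) (SlipEnergy.scaled α r) x)) ∧
    -- spatial localization
    IntegrableOn (SlipEnergy.bulkDensity Ψi g G) Ω ∧
    Tendsto (fun r => SlipEnergy.upscaledEnergy Ω (SlipEnergy.psiG Ψi g) α r g G) (𝓝[>] 0)
      (𝓝 (∫ x in Ω, SlipEnergy.psiG Ψi g x (SlipEnergy.grad g x - G x))) ∧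
    (∫ x in Ω, SlipEnergy.psiG Ψi g x (SlipEnergy.grad g x - G x) =
      ∫ x in Ω, Ψi (1 - (SlipEnergy.grad g x)⁻¹ * G x)) ∧
    (∫ x in Ω, Ψi (1 - (SlipEnergy.grad g x)⁻¹ * G x) =
      ∫ x in Ω, Ψi (1 - SlipEnergy.kTensor g G x)) ∧
    (∫ x in Ω, Ψi (1 - SlipEnergy.kTensor g G x) =
      ∫ x in Ω, Ψi (SlipEnergy.subDisarrangement g G x)) ∧
    -- the bulk density is a function of the submacroscopic disarrangements alone
    (∀ x ∈ Ω, SlipEnergy.bulkDensity Ψi g G x = Ψi (SlipEnergy.subDisarrangement g G x)) ∧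
    -- the bulk density is frame-indifferent
    (∀ Q ∈ Matrix.specialOrthogonalGroup (Fin 3) ℝ, ∀ c : SlipEnergy.E3, ∀ x ∈ Ω,
      SlipEnergy.bulkDensity Ψi (SlipEnergy.observedMap Q c g) (fun y => Q * G y) x =
        SlipEnergy.bulkDensity Ψi g G x) ∧
    -- the bulk density retains the periodicity along the slip planes
    (∀ x ∈ Ω, SlipEnergy.IsSlipPeriodic C
      (fun M => SlipEnergy.psiG Ψi g x (SlipEnergy.grad g x * M))) ∧
    (∀ (g' : SlipEnergy.E3 → SlipEnergy.E3) (G' : SlipEnergy.E3 → SlipEnergy.Mat),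
      SlipEnergy.IsCrystallographic C Ω g' G' →
      ∀ x ∈ Ω, ∀ (a b : Fin A) (ξ : ℝ) (v : SlipEnergy.E3) (n : ℤ), inner ℝ v (C.m a) = 0 →
        SlipEnergy.subDisarrangement g G x = SlipEnergy.slipMatrix C a b ξ v →
        SlipEnergy.subDisarrangement g' G' x =
          SlipEnergy.slipMatrix C a b ξ (v + ((n : ℝ) * C.p a) • C.s a) →
        SlipEnergy.bulkDensity Ψi g' G' x = SlipEnergy.bulkDensity Ψi g G x) := by
  obtain ⟨K, hK⟩ := hLip
  have hO := hΩ.isOpen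
  have hb := hΩ.isBounded
  have hI := hgG.isd
  obtain ⟨K₁, hK₁⟩ := hI.lipschitz_grad
  obtain ⟨K₂, hK₂⟩ := hI.lipschitz_grad_inv
  obtain ⟨N₁, hN₁0, hN₁⟩ := SlipEnergy.exists_norm_le_of_lipschitzOnWith hb hK₁
  obtain ⟨N, -, hN⟩ := SlipEnergy.exists_norm_le_of_lipschitzOnWith hb hK₂
  have hinv : ContinuousOn (fun x => (SlipEnergy.grad g x)⁻¹) Ω := hK₂.continuousOn
  have hC1 := hI.diffeo.1
  have hdiff : ∀ x ∈ Ω, DifferentiableAt ℝ g x := fun x hx =>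
    (hC1.differentiableOn (by simp)).differentiableAt (hO.mem_nhds hx)
  -- `G` is continuous on the compact set `closure Ω`, hence bounded there.
  obtain ⟨N₂, hN₂⟩ := hb.isCompact_closure.exists_bound_of_continuousOn hI.continuousOn
  have hF : ContinuousOn (fun x => SlipEnergy.grad g x - G x) Ω :=
    hK₁.continuousOn.sub (hI.continuousOn.mono subset_closure)
  have hFb : ∀ x ∈ Ω, ∀ i j, |(SlipEnergy.grad g x - G x) i j| ≤ N₁ + |N₂| :=
    fun x hx i j => (SlipEnergy.abs_apply_le_frobenius_norm _ i j).trans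
      ((norm_sub_le _ _).trans (add_le_add (hN₁ x hx)
        ((hN₂ x (subset_closure hx)).trans (le_abs_self _))))
  have hgradi : ∀ i j, IntegrableOn (fun x => SlipEnergy.grad g x i j) Ω := fun i j => by
    refine IntegrableOn.of_bound hb.measure_lt_top (ContinuousOn.aestronglyMeasurable
      (fun y hy => ?_) hO.measurableSet) N₁ ?_
    · exact ((continuous_apply j).tendsto _).comp
        (((continuous_apply i).tendsto _).comp (hK₁.continuousOn y hy))
    · filter_upwards [ae_restrict_mem hO.measurableSet] with x hx
      exact (SlipEnergy.abs_apply_le_frobenius_norm _ i j).trans (hN₁ x hx)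
  have hFi : ∀ i j, IntegrableOn (fun x => (SlipEnergy.grad g x - G x) i j) Ω := fun i j =>
    (hgradi i j).sub (hI.sd.2 i j)
  have hup : ∀ r, SlipEnergy.upscaledEnergy Ω (SlipEnergy.psiG Ψi g) α r g G =
      ∫ x in SlipEnergy.innerSet Ω r, SlipEnergy.psiG Ψi g x (SlipEnergy.fieldConv Ω
        (fun y => SlipEnergy.grad g y - G y) (SlipEnergy.scaled α r) x) := fun r => by
    -- `g` is of class `C¹`, so `Dˢg = 0` and the approximate gradient is the classical one.
    have hgi := hI.sd.1.integrable
    refine integral_congr_ae (ae_of_all _ fun x => congrArg (SlipEnergy.psiG Ψi g x) ?_)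
    have h2 : SlipEnergy.measConv (SlipEnergy.singularDeriv Ω g) (SlipEnergy.scaled α r) x = 0 := by
      ext i j
      simp [SlipEnergy.measConv,
        SlipEnergy.singularDeriv_eq_zero_of_contDiffOn hO hC1 hgi hgradi i j]
    rw [h2, add_zero]
    ext i j
    refine integral_congr_ae ?_
    filter_upwards [SlipEnergy.approxGrad_ae_eq_grad_of_contDiffOn hO hC1 hgi hgradi] with y hy
    simp only [hy]
  have hpsi : ∀ x ∈ Ω, SlipEnergy.psiG Ψi g x (SlipEnergy.grad g x - G x) =
      Ψi (1 - (SlipEnergy.grad g x)⁻¹ * G x) := fun x hx => hI.psiG_disarrangement Ψi hx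
  refine ⟨fun r hr u _ => ?_, fun r hr u hu => ?_, fun r hr => ⟨?_, hup r⟩, ?_, ?_, ?_, rfl, ?_,
    fun x hx => hI.bulkDensity_eq Ψi hx, fun Q hQ c x hx =>
      SlipEnergy.bulkDensity_observedMap Ψi hQ c (hdiff x hx) G, fun x hx => ?_, ?_⟩
  · obtain ⟨C', hC'⟩ := hα.exists_bound_scaled r
    obtain ⟨B, hB⟩ := SlipEnergy.exists_bound_measConv (SlipEnergy.singularDeriv Ω u) hC'
    exact SlipEnergy.integrableOn_psiG hb (SlipEnergy.isOpen_innerSet hO r)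
      (SlipEnergy.innerSet_subset Ω r) hK hinv hN
      (SlipEnergy.continuous_measConv _ (hα.continuous_scaled r) hC').continuousOn
      fun x _ => hB x
  · exact SlipEnergy.tendsto_interfacialEnergy hO hb hK hα hinv hN hr hu
  · obtain ⟨C', hC'⟩ := hα.exists_bound_scaled r
    exact SlipEnergy.integrableOn_psiG hb (SlipEnergy.isOpen_innerSet hO r)
      (SlipEnergy.innerSet_subset Ω r) hK hinv hN
      (SlipEnergy.continuous_fieldConv hFi (hα.continuous_scaled r) hC').continuousOn
      fun x _ => SlipEnergy.abs_fieldConv_scaled_le hO (by positivity) hFb hα hr x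
  · exact SlipEnergy.integrableOn_psiG hb hO subset_rfl hK hinv hN hF hFb
  · simp only [hup]
    exact SlipEnergy.tendsto_integral_psiG_fieldConv hO hb hK hα hinv hN hF (by positivity) hFb hFi
  · exact setIntegral_congr_fun hO.measurableSet hpsi
  · simp only [SlipEnergy.subDisarrangement_eq]
  · have hM : ∀ M, SlipEnergy.psiG Ψi g x (SlipEnergy.grad g x * M) = Ψi M := fun M => by
      rw [SlipEnergy.psiG, Matrix.nonsing_inv_mul_cancel_left _ _ (hI.isUnit_det_grad hx)]
    simpa only [hM] using hper
  · intro g' G' hgG' x hx a b ξ v n hv h1 h2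
    rw [hgG'.isd.bulkDensity_eq Ψi hx, hI.bulkDensity_eq Ψi hx, h1, h2]
    exact hper a b ξ v hv n
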